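/- All semigroups are nonempty unless stated otherwise. A \emph{pseudovariety} is a class of finite semigroups closed under homomorphic images, subsemigroups and finite direct products; $\mathsf S$ denotes the pseudovariety of all finite semigroups, and a pseudovariety is \emph{proper} if it is not $\mathsf S$. For a subsemigroup $U$ of a semigroup $S$, the \emph{dominion} $\mathrm{Dom}(U,S)$ is the set of all $d\in S$ such that any two morphisms from $S$ to a common semigroup which agree on $U$ also agree at $d$. A finite semigroup $S$ is \emph{F-saturated} if $\mathrm{Dom}(S,T)\neq T$ for every finite semigroup $T$ properly containing $S$ as a subsemigroup; a pseudovariety is F-saturated if all its members are. A pseudovariety $\mathsf V$ is \emph{F-epimorphically closed} if, whenever $S\in\mathsf V$, $T$ is a finite semigroup and $S\to T$ is an epimorphism in the category of all semigroups, then $T\in\mathsf V$. For an element $s$ of a finite semigroup, $s^\omega$ denotes its unique idempotent power and $s^{\omega+1}=s^\omega s$. Let \[ \mathsf V_1=[\![(exf)^{\omega+1}=exf]\!],\qquad \mathsf V_2=[\![exf(ef)^\omega=exf]\!],\qquad \mathsf V_3=[\![(ef)^\omega exf=exf]\!] \] be the pseudovarieties of all finite semigroups in which the indicated equality holds for all elements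 $x$ and all idempotents $e,f$. Let $Y=\{ab,a,ba,0\}$, a subsemigroup of the Brandt semigroup $B_2=\langle a,b : aba=a,\ bab=b,\ a^2=b^2=0\rangle$. \textbf{Theorem.} For every pseudovariety $\mathsf V$, exactly one of the following alternatives holds: \begin{enumerate} \item $\mathsf V$ is F-saturated and F-epimorphically closed, and $\mathsf V$ is contained in $\mathsf V_1$, in $\mathsf V_2$ or in $\mathsf V_3$; \item $\mathsf V$ is not F-saturated, and the only F-epimorphically closed pseudovariety containing $\mathsf V$ is $\mathsf S$. \end{enumerate} The second alternative holds if and only if $Y\in\mathsf V$. If $\mathsf V$ is proper, then $\mathsf V$ is F-epimorphically closed if and only if it is F-saturated. Moreover, F-saturation is decidable for pseudovarieties with decidable membership problem: there is an algorithm which, given any program that decides membership in some pseudovariety $\mathsf V$ (finite semigroups being given by their multiplication tables), halts and decides whether $\mathsf V$ is F-saturated. -/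

import Mathlib

namespace FinSemigroup

/-! ### The `ω`-power -/

/-- Positive powers in a semigroup: `ppow s n` is `s ^ (n + 1)`. -/
def ppow {S : Type} [Semigroup S] (s : S) : ℕ → S
  | 0 => s
  | n + 1 => ppow s n * s

theorem coe_ppow {S : Type} [Semigroup S] (s : S) (n : ℕ) :
    ((ppow s n : S) : WithOne S) = (s : WithOne S) ^ (n + 1) := by
  induction n with
  | zero => simp [ppow]
  | succ n ih => rw [ppow, WithOne.coe_mul, ih, ← pow_succ]

theorem map_ppow {S T : Type} [Semigroup S] [Semigroup T] (φ : S →ₙ* T) (s : S) (n : ℕ) :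
    φ (ppow s n) = ppow (φ s) n := by
  induction n with
  | zero => rfl
  | succ n ih => simp [ppow, ih]

theorem exists_idempotent_ppow {S : Type} [Semigroup S] [Finite S] (s : S) :
    ∃ e : S, IsIdempotentElem e ∧ ∃ n, ppow s n = e := by
  let _ : TopologicalSpace S := ⊥
  have : DiscreteTopology S := ⟨rfl⟩
  obtain ⟨e, ⟨n, hn⟩, he⟩ := exists_idempotent_in_compact_subsemigroup
    (fun _ : S => continuous_of_discreteTopology) (Set.range (ppow s)) ⟨s, 0, rfl⟩
    (Set.toFinite _).isCompact (by
      rintro _ ⟨m, rfl⟩ _ ⟨n, rfl⟩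
      refine ⟨m + n + 1, WithOne.coe_inj.1 ?_⟩
      rw [WithOne.coe_mul, coe_ppow, coe_ppow, coe_ppow, ← pow_add]
      congr 1
      omega)
  exact ⟨e, he, n, hn⟩

theorem idempotent_ppow_unique {S : Type} [Semigroup S] {s e f : S}
    (he : IsIdempotentElem e) (hf : IsIdempotentElem f)
    (hes : ∃ n, ppow s n = e) (hfs : ∃ n, ppow s n = f) : e = f := by
  obtain ⟨m, rfl⟩ := hes
  obtain ⟨n, rfl⟩ := hfs
  have he' : IsIdempotentElem ((ppow s m : S) : WithOne S) := by
    rw [IsIdempotentElem, ← WithOne.coe_mul, he.eq]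
  have hf' : IsIdempotentElem ((ppow s n : S) : WithOne S) := by
    rw [IsIdempotentElem, ← WithOne.coe_mul, hf.eq]
  have h1 := he'.pow_succ_eq n
  have h2 := hf'.pow_succ_eq m
  apply WithOne.coe_inj.1
  rw [← h1, ← h2, coe_ppow, coe_ppow, ← pow_mul, ← pow_mul, mul_comm]

/-- `s ^ ω`: the unique idempotent among the positive powers of an element `s` of a finite
semigroup. -/
noncomputable def omegaPow {S : Type} [Semigroup S] [Finite S] (s : S) : S :=
  (exists_idempotent_ppow s).choose

theorem omegaPow_idempotent {S : Type} [Semigroup S] [Finite S] (s : S) :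
    IsIdempotentElem (omegaPow s) :=
  (exists_idempotent_ppow s).choose_spec.1

theorem omegaPow_eq_ppow {S : Type} [Semigroup S] [Finite S] (s : S) :
    ∃ n, ppow s n = omegaPow s :=
  (exists_idempotent_ppow s).choose_spec.2

theorem map_omegaPow {S T : Type} [Semigroup S] [Finite S] [Semigroup T] [Finite T]
    (φ : S →ₙ* T) (s : S) : φ (omegaPow s) = omegaPow (φ s) := by
  refine idempotent_ppow_unique (s := φ s) ?_ (omegaPow_idempotent _) ?_ (omegaPow_eq_ppow _)
  · exact (omegaPow_idempotent s).map φ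
  · obtain ⟨n, hn⟩ := omegaPow_eq_ppow s
    exact ⟨n, by rw [← map_ppow, hn]⟩

theorem omegaPow_of_idempotent {S : Type} [Semigroup S] [Finite S] {e : S}
    (he : IsIdempotentElem e) : omegaPow e = e :=
  idempotent_ppow_unique (omegaPow_idempotent e) he (omegaPow_eq_ppow e) ⟨0, rfl⟩

/-! ### Dominions, epimorphisms and F-saturation -/

/-- The dominion of the subsemigroup `U` in the semigroup `S`. The morphisms considered are
morphisms into arbitrary (possibly infinite) semigroups. -/
def Dom {S : Type} [Semigroup S] (U : Subsemigroup S) : Set S :=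
  {d | ∀ (T : Type) [Semigroup T] (α β : S →ₙ* T), (∀ u ∈ U, α u = β u) → α d = β d}

/-- A finite semigroup `S` is F-saturated if it is not epimorphically embedded in any finite
semigroup `T` properly containing it. The containment is given by an injective
morphism `S → T`, proper when it is not onto. -/
def IsFSaturated (S : Type) [Semigroup S] [Finite S] : Prop :=
  ∀ (T : Type) [Semigroup T] [Finite T] (ι : S →ₙ* T),
    Function.Injective ι → ¬ Function.Surjective ι → Dom ι.srange ≠ Set.univ

/-! ### Pseudovarieties -/

/-- A pseudovariety of semigroups: a class of finite (nonempty) semigroups closed under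
homomorphic images, subsemigroups and finite direct products. -/
structure Pseudovariety where
  Mem : ∀ (S : Type) [Semigroup S] [Finite S] [Nonempty S], Prop
  image : ∀ (S T : Type) [Semigroup S] [Finite S] [Nonempty S]
    [Semigroup T] [Finite T] [Nonempty T] (φ : S →ₙ* T),
    Function.Surjective φ → Mem S → Mem T
  sub : ∀ (S : Type) [Semigroup S] [Finite S] [Nonempty S] (U : Subsemigroup S) [Nonempty U],
    Mem S → Mem U
  pi : ∀ (n : ℕ) (S : Fin n → Type) [∀ i, Semigroup (S i)] [∀ i, Finite (S i)]
    [∀ i, Nonempty (S i)], (∀ i, Mem (S i)) → Mem (∀ i, S i)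

namespace Pseudovariety

/-- Containment of pseudovarieties. -/
instance : LE Pseudovariety where
  le V W := ∀ (S : Type) [Semigroup S] [Finite S] [Nonempty S], V.Mem S → W.Mem S

/-- The pseudovariety of all finite semigroups. -/
def allFinite : Pseudovariety where
  Mem _ := True
  image := by intros; trivial
  sub := by intros; trivial
  pi := by intros; trivial

/-- All members are F-saturated. -/
def FSaturated (V : Pseudovariety) : Prop :=
  ∀ (S : Type) [Semigroup S] [Finite S] [Nonempty S], V.Mem S → IsFSaturated S

/-- If `S → T` is an epimorphism in the category of all semigroups, `T` is finite and `S`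
belongs to the class, then so does `T`. -/
def FEpimorphicallyClosed (V : Pseudovariety) : Prop :=
  ∀ (S T : Type) [Semigroup S] [Finite S] [Nonempty S] [Semigroup T] [Finite T] [Nonempty T]
    (φ : S →ₙ* T), CategoryTheory.Epi (Semigrp.ofHom φ) → V.Mem S → V.Mem T

/-- The pseudovariety defined by a pseudoidentity `t(e, x, f) = exf`, where `e`, `f` stand for
arbitrary idempotents, `x` for an arbitrary element, and `t` is a ternary operation on finite
semigroups that commutes with all morphisms. -/
def ofPseudoidentity (t : ∀ (S : Type) [Semigroup S] [Finite S], S → S → S → S)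
    (ht : ∀ (S T : Type) [Semigroup S] [Finite S] [Semigroup T] [Finite T] (φ : S →ₙ* T)
      (e x f : S), φ (t S e x f) = t T (φ e) (φ x) (φ f)) : Pseudovariety where
  Mem S := ∀ e x f : S, IsIdempotentElem e → IsIdempotentElem f → t S e x f = e * x * f
  image := by
    intro S T _ _ _ _ _ _ φ hφ h e x f he hf
    obtain ⟨e', rfl⟩ := hφ e
    obtain ⟨x', rfl⟩ := hφ x
    obtain ⟨f', rfl⟩ := hφ f
    rw [← omegaPow_of_idempotent he, ← omegaPow_of_idempotent hf, ← map_omegaPow,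
      ← map_omegaPow, ← ht,
      h _ _ _ (omegaPow_idempotent e') (omegaPow_idempotent f'), map_mul, map_mul]
  sub := by
    intro S _ _ _ U _ h e x f he hf
    apply Subtype.ext
    have := ht U S (MulMemClass.subtype U) e x f
    refine this.trans ?_
    exact h e x f (he.map (MulMemClass.subtype U)) (hf.map (MulMemClass.subtype U))
  pi := by
    intro n S _ _ _ h e x f he hf
    funext i
    have := ht (∀ i, S i) (S i) (Pi.evalMulHom S i) e x f
    refine this.trans ?_
    exact h i (e i) (x i) (f i) (he.map (Pi.evalMulHom S i)) (hf.map (Pi.evalMulHom S i))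

/-- `⟦(exf)^{ω+1} = exf⟧`, where `s^{ω+1} = s^ω s`. -/
noncomputable def V₁ : Pseudovariety :=
  ofPseudoidentity (fun _ _ _ e x f => omegaPow (e * x * f) * (e * x * f))
    (by intros; simp only [map_mul, map_omegaPow])

/-- `⟦exf(ef)^ω = exf⟧`. -/
noncomputable def V₂ : Pseudovariety :=
  ofPseudoidentity (fun _ _ _ e x f => e * x * f * omegaPow (e * f))
    (by intros; simp only [map_mul, map_omegaPow])

/-- `⟦(ef)^ω exf = exf⟧`. -/
noncomputable def V₃ : Pseudovariety :=
  ofPseudoidentity (fun _ _ _ e x f => omegaPow (e * f) * (e * x * f))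
    (by intros; simp only [map_mul, map_omegaPow])

end Pseudovariety

/-! ### The semigroup `Y` -/

/-- The subsemigroup `{ab, a, ba, 0}` of the five-element Brandt semigroup
`B₂ = ⟨a, b : aba = a, bab = b, a² = b² = 0⟩`. -/
inductive Y : Type
  | ab
  | a
  | ba
  | zero

namespace Y

/-- The multiplication of `Y`; all products not listed are zero. -/
def mul : Y → Y → Y
  | ab, ab => ab
  | ab, a => a
  | a, ba => a
  | ba, ba => ba
  | _, _ => zero

instance : Semigroup Y where
  mul := mul
  mul_assoc x y z := by cases x <;> cases y <;> cases z <;> rfl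

instance : Finite Y :=
  Finite.of_surjective (![ab, a, ba, zero] : Fin 4 → Y) (by
    intro y
    cases y
    exacts [⟨0, rfl⟩, ⟨1, rfl⟩, ⟨2, rfl⟩, ⟨3, rfl⟩])

instance : Nonempty Y := ⟨zero⟩

end Y

/-! ### Decidability of membership -/

/-- The multiplication table of a semigroup whose elements are listed as
`e 0, …, e (n - 1)`: the entry in row `i` and column `j` is the index of `e i * e j`. -/
def mulTable {S : Type} [Semigroup S] {n : ℕ} (e : Fin n ≃ S) : List (List ℕ) :=
  List.ofFn fun i => List.ofFn fun j => (e.symm (e i * e j) : ℕ)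

/-- The program `c` decides membership in `V`: on input (the code of) a multiplication table of
a finite semigroup, it halts with output `1` if the semigroup belongs to `V` and `0` if not. -/
def DecidesMembership (c : Nat.Partrec.Code) (V : Pseudovariety) : Prop :=
  ∀ (S : Type) [Semigroup S] [Finite S] [Nonempty S] (n : ℕ) (e : Fin n ≃ S),
    (V.Mem S → 1 ∈ c.eval (Encodable.encode (mulTable e))) ∧
    (¬ V.Mem S → 0 ∈ c.eval (Encodable.encode (mulTable e)))

end FinSemigroup

/-!
Isbell's zigzag theorem turns `Dom S T = T` into the identity `d ⊗ 1 = 1 ⊗ d` in `T¹ ⊗ T¹` over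
`S¹`. If this holds for all `d` and `S ≠ T`, a `𝓙`-maximal element outside `S` gives idempotents
`i`, `j` of `S¹`, an element `a` outside `S¹` with `a i = a`, and `s = i s j` in `S¹` with
`i ∈ s T¹`, `j ∈ T¹ s` and `a s ∈ S¹`. Each of the three pseudoidentities gives `s^ω i = i`, so that
`a = a s^ω i` lies in `S¹` after all.

If `Y` belongs to a pseudovariety, so does the subdirect power of `Y` in which `a` is replaced by a
family indexed by a finite monoid `M`. It is the triangular part of the Brandt semigroup of `2 × 2`
matrix units over `M`, and it dominates that semigroup because inverses are unique. An
F-epimorphically closed pseudovariety containing `Y` therefore contains these Brandt semigroups and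
their subsemigroups `M`.

If `Y` is not in the pseudovariety, then in any member with idempotents `e`, `f` and `s = e s f`, a
set that contains `f e` and is closed under multiplication by `e`, `s`, `f` contains `s`, unless
`s = e f`; otherwise `Y` would be a divisor. Suitable choices of this set give: first, `e f` is
always a group element; next, if the local submonoids are completely regular, every `s = e s f` is
a group element; finally, if some local submonoid is not completely regular, `(ef)^ω` fixes each
`s = e s f` on one side, and the same side serves for all `s` by passing to direct products.
-/

namespace FinSemigroup

/-! ### Calculus of `ω`-powers -/

section OmegaPower

instance {S : Type} [Finite S] : Finite (WithOne S) :=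
  inferInstanceAs (Finite (Option S))

theorem coe_omegaPow {S : Type} [Semigroup S] [Finite S] (s : S) :
    ((omegaPow s : S) : WithOne S) = omegaPow (s : WithOne S) :=
  map_omegaPow WithOne.coeMulHom s

theorem ppow_eq_pow {M : Type} [Monoid M] (s : M) (n : ℕ) : ppow s n = s ^ (n + 1) := by
  induction n with
  | zero => simp [ppow]
  | succ n ih => rw [ppow, ih, ← pow_succ]

theorem exists_omegaPow_eq_pow {M : Type} [Monoid M] [Finite M] (s : M) :
    ∃ n, omegaPow s = s ^ (n + 1) := by
  obtain ⟨n, hn⟩ := omegaPow_eq_ppow s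
  exact ⟨n, by rw [← hn, ppow_eq_pow]⟩

theorem eq_pow_mul_mul_pow {M : Type*} [Monoid M] {x u v : M} (h : x = u * x * v) (n : ℕ) :
    x = u ^ n * x * v ^ n := by
  induction n with
  | zero => simp
  | succ n ih =>
    calc x = u ^ n * (u * x * v) * v ^ n := by rw [← h, ← ih]
      _ = u ^ (n + 1) * x * v ^ (n + 1) := by simp only [pow_succ u, pow_succ' v, mul_assoc]

theorem omegaPow_mul_of_eq_mul_mul {M : Type} [Monoid M] [Finite M] {x u v : M}
    (h : x = u * x * v) : omegaPow u * x = x := by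
  obtain ⟨n, hn⟩ := exists_omegaPow_eq_pow u
  have hx := eq_pow_mul_mul_pow h (n + 1)
  rw [← hn] at hx
  rw [hx, ← mul_assoc, ← mul_assoc, (omegaPow_idempotent u).eq]

theorem mul_omegaPow_of_eq_mul_mul {M : Type} [Monoid M] [Finite M] {x u v : M}
    (h : x = u * x * v) : x * omegaPow v = x := by
  obtain ⟨n, hn⟩ := exists_omegaPow_eq_pow v
  have hx := eq_pow_mul_mul_pow h (n + 1)
  rw [← hn] at hx
  rw [hx, mul_assoc, (omegaPow_idempotent v).eq]

variable {S : Type} [Semigroup S] [Finite S]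

theorem omegaPow_mul_of_coe_eq {s a : S} {q : WithOne S} (h : (s : WithOne S) = a * s * q) :
    omegaPow a * s = s :=
  WithOne.coe_inj.1 <| by
    rw [WithOne.coe_mul, coe_omegaPow, omegaPow_mul_of_eq_mul_mul h]

theorem semiconjBy_omegaPow {a x y : S} (h : SemiconjBy a x y) :
    SemiconjBy a (omegaPow x) (omegaPow y) := by
  obtain ⟨m, hm⟩ := exists_omegaPow_eq_pow (x : WithOne S)
  obtain ⟨n, hn⟩ := exists_omegaPow_eq_pow (y : WithOne S)
  have hx := (omegaPow_idempotent (x : WithOne S)).pow_succ_eq n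
  have hy := (omegaPow_idempotent (y : WithOne S)).pow_succ_eq m
  rw [hm, ← pow_mul, ← hm] at hx
  rw [hn, ← pow_mul, mul_comm, ← hn] at hy
  have hcoe : SemiconjBy (a : WithOne S) x y := congrArg WithOne.coe h.eq
  have hpow := hcoe.pow_right ((m + 1) * (n + 1))
  rw [hx, hy, ← coe_omegaPow, ← coe_omegaPow] at hpow
  exact WithOne.coe_inj.1 hpow.eq

theorem omegaPow_mul_self_comm (s : S) : omegaPow s * s = s * omegaPow s :=
  (semiconjBy_omegaPow (rfl : SemiconjBy s s s)).eq.symm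

end OmegaPower

/-! ### The tensor square over a submonoid -/

/-- The elementary moves defining the tensor product `M ⊗_N M`. -/
inductive TensorRel {M : Type*} [Monoid M] (N : Submonoid M) : M × M → M × M → Prop
  | move (x u y : M) (hu : u ∈ N) : TensorRel N (x * u, y) (x, u * y)

/-- The tensor product `M ⊗_N M` of a monoid with itself over a submonoid. -/
def TensorSq {M : Type*} [Monoid M] (N : Submonoid M) : Type _ := Quot (TensorRel N)

namespace TensorSq

variable {M : Type*} [Monoid M] {N : Submonoid M}

/-- The pure tensor `x ⊗ y`. -/
def tmul (N : Submonoid M) (x y : M) : TensorSq N := Quot.mk _ (x, y)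

theorem mul_tmul {u : M} (hu : u ∈ N) (x y : M) : tmul N (x * u) y = tmul N x (u * y) :=
  Quot.sound (.move x u y hu)

/-- The map out of `M ⊗_N M` induced by a balanced map on `M × M`. -/
def lift {α : Sort*} (f : M → M → α) (hf : ∀ u ∈ N, ∀ x y, f (x * u) y = f x (u * y)) :
    TensorSq N → α :=
  Quot.lift (fun p => f p.1 p.2) (by rintro _ _ ⟨x, u, y, hu⟩; exact hf u hu x y)

@[ext]
theorem funext {α : Sort*} {f g : TensorSq N → α} (h : ∀ x y, f (tmul N x y) = g (tmul N x y)) :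
    f = g :=
  _root_.funext <| Quot.ind fun p => h p.1 p.2

/-- The left action of `M` on `M ⊗_N M`. -/
def lmul (m : M) : TensorSq N → TensorSq N :=
  lift (fun x y => tmul N (m * x) y) fun u hu x y => by rw [← mul_assoc, mul_tmul hu]

/-- The right action of `M` on `M ⊗_N M`. -/
def rmul (m : M) : TensorSq N → TensorSq N :=
  lift (fun x y => tmul N x (y * m)) fun u hu x y => by rw [mul_tmul hu, mul_assoc]

@[simp]
theorem lmul_tmul (m x y : M) : lmul m (tmul N x y) = tmul N (m * x) y := rfl

@[simp]
theorem rmul_tmul (m x y : M) : rmul m (tmul N x y) = tmul N x (y * m) := rfl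

theorem lmul_mul (m n : M) : lmul (N := N) (m * n) = lmul m ∘ lmul n := by
  ext x y; simp [mul_assoc]

theorem rmul_mul (m n : M) : rmul (N := N) (m * n) = rmul n ∘ rmul m := by
  ext x y; simp [mul_assoc]

theorem lmul_comp_rmul (m n : M) : lmul (N := N) m ∘ rmul n = rmul n ∘ lmul m := by
  ext x y; simp

open MulOpposite in
/-- The flip `x ⊗ y ↦ y ⊗ x` onto the tensor square of the opposite monoid. -/
def flip : TensorSq N → TensorSq N.op :=
  lift (fun x y => tmul N.op (op y) (op x)) fun u hu x y => by
    rw [op_mul, op_mul, mul_tmul (N := N.op) (u := op u) hu]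

end TensorSq

/-- The split extension of `M` by the free abelian group on the bimodule `M ⊗_N M`. -/
@[ext]
structure TensorExt {M : Type*} [Monoid M] (N : Submonoid M) where
  base : M
  fibre : FreeAbelianGroup (TensorSq N)

namespace TensorExt

open FreeAbelianGroup TensorSq

variable {M : Type*} [Monoid M] {N : Submonoid M}

noncomputable instance : Mul (TensorExt N) where
  mul p q := ⟨p.base * q.base, map (lmul p.base) q.fibre + map (rmul q.base) p.fibre⟩

theorem mul_base (p q : TensorExt N) : (p * q).base = p.base * q.base := rfl

theorem mul_fibre (p q : TensorExt N) :
    (p * q).fibre = map (lmul p.base) q.fibre + map (rmul q.base) p.fibre := rfl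

noncomputable instance : Semigroup (TensorExt N) where
  mul_assoc p q r := by
    refine TensorExt.ext (mul_assoc _ _ _) ?_
    simp only [mul_fibre, mul_base, map_add, lmul_mul, rmul_mul, ← map_comp_apply,
      lmul_comp_rmul, add_assoc]

/-- The trivial section. -/
noncomputable def section₀ (N : Submonoid M) : M →ₙ* TensorExt N where
  toFun m := ⟨m, 0⟩
  map_mul' m n := TensorExt.ext rfl (by simp [mul_fibre])

/-- The section given by the inner derivation `m ↦ m ⊗ 1 - 1 ⊗ m`. -/
noncomputable def section₁ (N : Submonoid M) : M →ₙ* TensorExt N where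
  toFun m := ⟨m, of (tmul N m 1) - of (tmul N 1 m)⟩
  map_mul' m n := TensorExt.ext rfl (by simp [mul_fibre, map_of_apply])

theorem section₀_eq_section₁_iff {m : M} :
    section₀ N m = section₁ N m ↔ tmul N m 1 = tmul N 1 m := by
  simp [section₀, section₁, TensorExt.ext_iff, eq_comm (a := (0 : FreeAbelianGroup _)),
    sub_eq_zero, of_injective.eq_iff]

end TensorExt

open TensorSq in
/-- One half of Isbell's zigzag theorem. -/
theorem tmul_one_eq_one_tmul_of_mem_Dom {T M : Type} [Semigroup T] [Monoid M] {N : Submonoid M}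
    {U : Subsemigroup T} (j : T →ₙ* M) (hj : ∀ u ∈ U, j u ∈ N) {d : T} (hd : d ∈ Dom U) :
    tmul N (j d) 1 = tmul N 1 (j d) :=
  TensorExt.section₀_eq_section₁_iff.1 <|
    hd _ ((TensorExt.section₀ N).comp j) ((TensorExt.section₁ N).comp j) fun u hu =>
      TensorExt.section₀_eq_section₁_iff.2 <| by simpa using mul_tmul (hj u hu) 1 1

/-! ### The `𝓙`-order -/

/-- Green's `𝓙`-preorder: `x` lies in the two-sided ideal generated by `y`. -/
def JLe {M : Type*} [Monoid M] (x y : M) : Prop := ∃ p q, x = p * y * q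

namespace JLe

variable {M : Type*} [Monoid M] {x y z : M}

theorem refl (x : M) : JLe x x := ⟨1, 1, by simp⟩

theorem trans : JLe x y → JLe y z → JLe x z := by
  rintro ⟨p, q, rfl⟩ ⟨r, t, rfl⟩
  exact ⟨p * r, t * q, by simp only [mul_assoc]⟩

theorem mul_right (x y : M) : JLe (x * y) x := ⟨1, y, by simp⟩

theorem mul_left (x y : M) : JLe (x * y) y := ⟨x, 1, by simp⟩

open MulOpposite in
theorem op_iff : JLe (op x) (op y) ↔ JLe x y := by
  constructor
  · rintro ⟨p, q, h⟩
    exact ⟨q.unop, p.unop, by simpa [mul_assoc] using congrArg unop h⟩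
  · rintro ⟨p, q, rfl⟩
    exact ⟨op q, op p, by simp [mul_assoc]⟩

end JLe

theorem JLe.exists_mul_right {M : Type} [Monoid M] [Finite M] {x v : M} (h : JLe x (x * v)) :
    ∃ w, x = x * v * w := by
  obtain ⟨p, q, h⟩ := h
  obtain ⟨n, hn⟩ := exists_omegaPow_eq_pow (v * q)
  have hx : x * omegaPow (v * q) = x :=
    mul_omegaPow_of_eq_mul_mul (u := p) (by simpa only [mul_assoc] using h)
  refine ⟨q * (v * q) ^ n, ?_⟩
  rw [hn, pow_succ'] at hx
  simpa only [mul_assoc] using hx.symm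

instance {M : Type*} [Finite M] : Finite Mᵐᵒᵖ :=
  Finite.of_equiv M MulOpposite.opEquiv

open MulOpposite in
theorem JLe.exists_mul_left {M : Type} [Monoid M] [Finite M] {x v : M} (h : JLe x (v * x)) :
    ∃ w, x = w * (v * x) := by
  obtain ⟨w, hw⟩ := (JLe.op_iff.2 h : JLe (op x) (op x * op v)).exists_mul_right
  exact ⟨w.unop, by simpa using congrArg unop hw⟩

/-! ### Dominating submonoids of finite monoids -/

/-- `N` dominates `M`: every `d : M` satisfies the zigzag criterion `d ⊗ 1 = 1 ⊗ d` in
`M ⊗_N M`. -/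
def Dominating {M : Type*} [Monoid M] (N : Submonoid M) : Prop :=
  ∀ d, TensorSq.tmul N d 1 = TensorSq.tmul N 1 d

/-- `d` is `𝓙`-maximal among the elements outside `N`. -/
def MaximalOutside {M : Type*} [Monoid M] (N : Submonoid M) (d : M) : Prop :=
  d ∉ N ∧ ∀ x ∉ N, JLe d x → JLe x d

section Duality

open MulOpposite

variable {M : Type*} [Monoid M] {N : Submonoid M}

theorem Dominating.op (hN : Dominating N) : Dominating N.op := fun d =>
  (congrArg TensorSq.flip (hN d.unop)).symm

theorem MaximalOutside.op {d : M} (hd : MaximalOutside N d) : MaximalOutside N.op (op d) :=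
  ⟨hd.1, fun x hx h => JLe.op_iff.2 <| hd.2 x.unop hx <| JLe.op_iff.1 h⟩

end Duality

section Maximal

variable {M : Type*} [Monoid M] {N : Submonoid M}

theorem exists_maximalOutside [Finite M] {x : M} (hx : x ∉ N) : ∃ d, MaximalOutside N d := by
  obtain ⟨d, hd⟩ :=
    Set.Finite.exists_maximalFor (fun y => {z | JLe z y}) {x | x ∉ N} (Set.toFinite _) ⟨x, hx⟩
  exact ⟨d, hd.1, fun y hy hdy => hd.2 hy (fun z hz => hz.trans hdy) (JLe.refl y)⟩

theorem MaximalOutside.of_JLe {d y : M} (hd : MaximalOutside N d) (hy : y ∉ N) (h : JLe d y) :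
    MaximalOutside N y :=
  ⟨hy, fun x hx hyx => (hd.2 x hx (h.trans hyx)).trans h⟩

/-- Along a zigzag from `d ⊗ 1` to `1 ⊗ d` the left factor moves from outside `N` into `N`. -/
theorem Dominating.exists_transition (hN : Dominating N) {d : M} (hd : d ∉ N) :
    ∃ x, ∃ u ∈ N, ∃ y, x ∉ N ∧ x * u ∈ N ∧ d = x * u * y := by
  by_contra! hno
  let P : TensorSq N → Prop := TensorSq.lift (fun x y => x * y = d ∧ x ∉ N) fun u hu x y => by
    refine propext ⟨fun ⟨h, hx⟩ => ⟨by rw [← h, mul_assoc], fun hxN => hx (N.mul_mem hxN hu)⟩,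
      fun ⟨h, hx⟩ => ⟨by rw [← h, mul_assoc], fun hxu => hno x u hu y hx hxu ?_⟩⟩
    rw [← h, mul_assoc]
  have h : P (TensorSq.tmul N d 1) := ⟨mul_one d, hd⟩
  rw [hN d] at h
  exact h.2 N.one_mem

theorem exists_rel_loop {α : Type*} [Finite α] (r : α → α → Prop) [IsTrans α r]
    (hserial : ∀ a, ∃ b, r a b) (a : α) : ∃ b, r a b ∧ r b b := by
  by_contra! hno
  let s : {b // r a b} → {b // r a b} → Prop := fun b c => r c b
  have : IsTrans _ s := ⟨fun _ _ _ hbc hcd => _root_.trans (r := r) hcd hbc⟩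
  have : Std.Irrefl s := ⟨fun b => hno b b.2⟩
  obtain ⟨b, hb⟩ := hserial a
  obtain ⟨m, -, hm⟩ :=
    (Finite.wellFounded_of_trans_of_irrefl s).has_min Set.univ ⟨⟨b, hb⟩, trivial⟩
  obtain ⟨c, hc⟩ := hserial m
  exact hm ⟨c, _root_.trans m.2 hc⟩ trivial hc

end Maximal

section Factor

variable {M : Type} [Monoid M] [Finite M] {N : Submonoid M} {d : M}

theorem MaximalOutside.exists_left_factor (hd : MaximalOutside N d) (hN : Dominating N) :
    ∃ c ∈ N, ∃ i ∈ N, ∃ z, z ∉ N ∧ IsIdempotentElem i ∧ d = c * z ∧ i * z = z ∧ JLe i d := by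
  let r : {z // MaximalOutside N z} → {z // MaximalOutside N z} → Prop :=
    fun a b => ∃ c ∈ N, a.1 = c * b.1 ∧ JLe c a.1 ∧ JLe b.1 a.1
  have : IsTrans _ r := ⟨by
    rintro a b c ⟨p, hp, hab, hpa, hba⟩ ⟨q, hq, hbc, -, hcb⟩
    exact ⟨p * q, N.mul_mem hp hq, by rw [hab, hbc, mul_assoc],
      (JLe.mul_right p q).trans hpa, hcb.trans hba⟩⟩
  have hserial : ∀ a, ∃ b, r a b := by
    rintro ⟨a, ha⟩
    obtain ⟨x, u, -, y, hx, hxu, hay⟩ := hN.exists_transition ha.1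
    have hy : y ∉ N := fun hy => ha.1 (hay ▸ N.mul_mem hxu hy)
    have hJx : JLe a x := hay ▸ (JLe.mul_right (x * u) y).trans (JLe.mul_right x u)
    have hJy : JLe a y := hay ▸ JLe.mul_left (x * u) y
    exact ⟨⟨y, ha.of_JLe hy hJy⟩, x * u, hxu, hay,
      (JLe.mul_right x u).trans (ha.2 x hx hJx), ha.2 y hy hJy⟩
  obtain ⟨⟨z, hz⟩, ⟨c, hc, hdz, -, hzd⟩, p, hp, hpz, hpJ, -⟩ := exists_rel_loop r hserial ⟨d, hd⟩
  obtain ⟨n, hn⟩ := exists_omegaPow_eq_pow p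
  refine ⟨c, hc, omegaPow p, hn ▸ N.pow_mem hp _, z, hz.1, omegaPow_idempotent p, hdz,
    omegaPow_mul_of_eq_mul_mul (v := 1) (by simpa using hpz), ?_⟩
  rw [hn, pow_succ]
  exact (JLe.mul_left _ _).trans (hpJ.trans hzd)

open MulOpposite in
theorem MaximalOutside.exists_right_factor (hd : MaximalOutside N d) (hN : Dominating N) :
    ∃ c ∈ N, ∃ i ∈ N, ∃ z, z ∉ N ∧ IsIdempotentElem i ∧ d = z * c ∧ z * i = z ∧ JLe i d := by
  obtain ⟨c, hc, i, hi, z, hz, hii, hdz, hiz, hid⟩ := hd.op.exists_left_factor hN.op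
  exact ⟨c.unop, hc, i.unop, hi, z.unop, hz, congrArg unop hii.eq, congrArg unop hdz,
    congrArg unop hiz, JLe.op_iff.1 hid⟩

theorem Dominating.exists_link (hN : Dominating N) (hd : d ∉ N) :
    ∃ a, a ∉ N ∧ ∃ i ∈ N, ∃ j ∈ N, ∃ s ∈ N, IsIdempotentElem i ∧ IsIdempotentElem j ∧
      a * i = a ∧ a * s ∈ N ∧ i * s * j = s ∧ (∃ z, s * z = i) ∧ ∃ m, m * s = j := by
  obtain ⟨d, hd⟩ := exists_maximalOutside hd
  obtain ⟨x, u, hu, y₀, hx, hxu, hdx⟩ := hN.exists_transition hd.1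
  have hd_xu : JLe d (x * u) := hdx ▸ JLe.mul_right (x * u) y₀
  have hd_x : JLe d x := hd_xu.trans (JLe.mul_right x u)
  have hx_max : MaximalOutside N x := hd.of_JLe hx hd_x
  obtain ⟨c, hc, i, hi, a, ha, hii, rfl, hai, hi_x⟩ := hx_max.exists_right_factor hN
  have hx_a : JLe (a * c) a := JLe.mul_right a c
  have ha_max : MaximalOutside N a := hx_max.of_JLe ha hx_a
  obtain ⟨y, hy⟩ : ∃ y, a = a * (c * u) * y := JLe.exists_mul_right <| by
    rw [← mul_assoc]
    exact (hx_max.2 a ha hx_a).trans ((hd.2 _ hx hd_x).trans hd_xu)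
  rw [← mul_assoc] at hy
  have hyN : y ∉ N := fun h => ha (hy ▸ N.mul_mem hxu h)
  have ha_y : JLe a y := ⟨a * c * u, 1, by rw [mul_one]; exact hy⟩
  obtain ⟨c', hc', j, hj, z, -, hjj, rfl, hjz, hj_y⟩ :=
    (ha_max.of_JLe hyN ha_y).exists_left_factor hN
  set s := i * c * u * c' * j with hs
  have hsN : s ∈ N := N.mul_mem (N.mul_mem (N.mul_mem (N.mul_mem hi hc) hu) hc') hj
  have his : i * s = s := by simp only [hs, ← mul_assoc, hii.eq]
  have hsj : s * j = s := by rw [hs, mul_assoc, hjj.eq]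
  have has : a * s = a * c * u * (c' * j) := by simp only [hs, ← mul_assoc, hai]
  have hasz : a * s * z = a := by rw [has, mul_assoc, mul_assoc c', hjz]; exact hy.symm
  obtain ⟨k, hk⟩ : ∃ k, i = k * (a * i) :=
    JLe.exists_mul_left <| by rw [hai]; exact hi_x.trans hx_a
  rw [hai] at hk
  obtain ⟨m, hm⟩ : ∃ m, j = m * (s * j) := JLe.exists_mul_left <| by
    rw [hsj]
    exact (hj_y.trans (ha_max.2 _ hyN ha_y)).trans ⟨a, z, hasz.symm⟩
  have hsz : s * z = i :=
    calc s * z = k * (a * s * z) := by rw [← mul_assoc, ← mul_assoc, ← hk, his]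
      _ = i := by rw [hasz, ← hk]
  exact ⟨a, ha, i, hi, j, hj, s, hsN, hii, hjj, hai,
    has ▸ N.mul_mem hxu (N.mul_mem hc' hj), by rw [his, hsj], ⟨z, hsz⟩, m, by rw [hm, hsj]⟩

theorem Dominating.eq_top (hN : Dominating N)
    (hlink : ∀ i ∈ N, ∀ j ∈ N, ∀ s ∈ N, IsIdempotentElem i → IsIdempotentElem j →
      i * s * j = s → (∃ z, s * z = i) → (∃ m, m * s = j) → omegaPow s * i = i) : N = ⊤ := by
  refine eq_top_iff.2 fun d _ => ?_
  by_contra hd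
  obtain ⟨a, ha, i, hi, j, hj, s, hs, hii, hjj, hai, has, hisj, hsz, hms⟩ := hN.exists_link hd
  obtain ⟨n, hn⟩ := exists_omegaPow_eq_pow s
  have ha_eq : a = a * s * (s ^ n * i) := by
    rw [mul_assoc, ← mul_assoc s, ← pow_succ', ← hn,
      hlink i hi j hj s hs hii hjj hisj hsz hms, hai]
  exact ha (ha_eq ▸ N.mul_mem has (N.mul_mem (N.pow_mem hs n) hi))

end Factor

/-! ### F-saturation from pseudoidentities -/

theorem omegaPow_mul_eq_of_link {M : Type} [Monoid M] [Finite M] {i j s z m : M}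
    (hi : IsIdempotentElem i) (hj : IsIdempotentElem j) (his : i * s * j = s) (hsz : s * z = i)
    (hms : m * s = j) (h : omegaPow s * s = s ∨ s * omegaPow (i * j) = s ∨
      omegaPow (i * j) * s = s) : omegaPow s * i = i := by
  have of_self (hs : omegaPow s * s = s) : omegaPow s * i = i := by rw [← hsz, ← mul_assoc, hs]
  have hs_j : s * j = s := by rw [← his, mul_assoc, hj.eq]
  obtain ⟨n, hn⟩ := exists_omegaPow_eq_pow (i * j)
  rcases h with h | h | h
  · exact of_self h
  · have hik : i * omegaPow (i * j) = omegaPow (i * j) := by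
      rw [hn, pow_succ', ← mul_assoc, ← mul_assoc, hi.eq]
    refine omegaPow_mul_of_eq_mul_mul (v := omegaPow (i * j) * z) ?_
    rw [mul_assoc s, ← mul_assoc i, hik, ← mul_assoc, h, hsz]
  · have hkj : omegaPow (i * j) * j = omegaPow (i * j) := by
      rw [hn, pow_succ, mul_assoc, mul_assoc, hj.eq]
    have hjs : j * omegaPow s = j := mul_omegaPow_of_eq_mul_mul (u := m * omegaPow (i * j)) <| by
      rw [mul_assoc m, hkj, mul_assoc, h, hms]
    refine of_self ?_
    calc omegaPow s * s = s * j * omegaPow s := by rw [omegaPow_mul_self_comm, hs_j]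
      _ = s := by rw [mul_assoc, hjs, hs_j]

theorem eq_one_and_eq_one_of_mul_eq_one {T : Type*} [Semigroup T] {a b : WithOne T}
    (h : a * b = 1) : a = 1 ∧ b = 1 := by
  induction a with
  | one => exact ⟨rfl, by rwa [one_mul] at h⟩
  | coe a =>
    induction b with
    | one => rw [mul_one] at h; exact absurd h WithOne.coe_ne_one
    | coe b => rw [← WithOne.coe_mul] at h; exact absurd h WithOne.coe_ne_one

section Extension

variable {S : Type} [Semigroup S]

theorem dominating_mrange_mapMulHom {T : Type} [Semigroup T] {φ : S →ₙ* T}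
    (h : Dom φ.srange = Set.univ) : Dominating (MonoidHom.mrange (WithOne.mapMulHom φ)) := by
  intro d
  induction d with
  | one => rfl
  | coe d =>
    refine tmul_one_eq_one_tmul_of_mem_Dom WithOne.coeMulHom (U := φ.srange) ?_
      (h ▸ Set.mem_univ d)
    rintro _ ⟨s, rfl⟩
    exact ⟨s, WithOne.mapMulHom_coe φ s⟩

theorem isFSaturated_of_identity [Finite S]
    (hS : ∀ e x f : S, IsIdempotentElem e → IsIdempotentElem f →
      omegaPow (e * x * f) * (e * x * f) = e * x * f ∨
      e * x * f * omegaPow (e * f) = e * x * f ∨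
      omegaPow (e * f) * (e * x * f) = e * x * f) : IsFSaturated S := by
  intro T _ _ φ hφ hsurj hDom
  let ψ : WithOne S →* WithOne T := WithOne.mapMulHom φ
  let χ : S →ₙ* WithOne T := WithOne.coeMulHom.comp φ
  have hχ : Function.Injective χ := fun a b hab => hφ (WithOne.coe_inj.1 hab)
  have htop : MonoidHom.mrange ψ = ⊤ := by
    refine (dominating_mrange_mapMulHom hDom).eq_top ?_
    rintro _ ⟨i, rfl⟩ _ ⟨j, rfl⟩ _ ⟨s, rfl⟩ hi hj hisj ⟨z, hz⟩ ⟨m, hm⟩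
    refine omegaPow_mul_eq_of_link hi hj hisj hz hm ?_
    by_cases hs : ψ s = 1
    · rw [hs, omegaPow_of_idempotent .one, one_mul]
      exact .inl rfl
    cases i with
    | one => exact absurd (eq_one_and_eq_one_of_mul_eq_one (hz.trans (map_one ψ))).1 hs
    | coe e =>
    cases j with
    | one => exact absurd (eq_one_and_eq_one_of_mul_eq_one (hm.trans (map_one ψ))).2 hs
    | coe f =>
    cases s with
    | one => exact absurd (map_one ψ) hs
    | coe s =>
    have hesf : e * s * f = s := hχ <| by rw [map_mul, map_mul]; exact hisj
    have h := hS e s f (hχ <| by rw [map_mul]; exact hi.eq) (hχ <| by rw [map_mul]; exact hj.eq)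
    rw [hesf, ← hχ.eq_iff, ← hχ.eq_iff, ← hχ.eq_iff] at h
    simp only [map_mul, map_omegaPow] at h
    exact h
  refine hsurj fun t => ?_
  obtain ⟨s, hs⟩ : (t : WithOne T) ∈ MonoidHom.mrange ψ := htop ▸ Submonoid.mem_top _
  cases s with
  | one => exact absurd hs WithOne.one_ne_coe
  | coe s => exact ⟨s, WithOne.coe_inj.1 hs⟩

end Extension

/-! ### Epimorphisms -/

theorem Dom_srange_eq_univ_iff_epi {S T : Type} [Semigroup S] [Semigroup T] (φ : S →ₙ* T) :
    Dom φ.srange = Set.univ ↔ CategoryTheory.Epi (Semigrp.ofHom φ) := by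
  constructor
  · intro h
    refine ⟨fun {Z} g k hgk => Semigrp.hom_ext (MulHom.ext fun t => ?_)⟩
    refine (h ▸ Set.mem_univ t : t ∈ Dom φ.srange) Z g.hom k.hom ?_
    rintro _ ⟨s, rfl⟩
    exact congrArg (fun m => m.hom s) hgk
  · intro h
    refine Set.eq_univ_of_forall fun t Z _ α β hαβ => ?_
    have hαβ' : Semigrp.ofHom α = Semigrp.ofHom β := by
      rw [← CategoryTheory.cancel_epi (Semigrp.ofHom φ)]
      exact Semigrp.hom_ext (MulHom.ext fun s => hαβ _ ⟨s, rfl⟩)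
    exact congrArg (fun m => m.hom t) hαβ'

namespace Pseudovariety

theorem fSaturated_of_le {V : Pseudovariety} (h : V ≤ V₁ ∨ V ≤ V₂ ∨ V ≤ V₃) :
    V.FSaturated := fun S _ _ _ hS =>
  isFSaturated_of_identity fun e x f he hf =>
    h.imp (· S hS e x f he hf) (Or.imp (· S hS e x f he hf) (· S hS e x f he hf))

theorem FSaturated.fEpimorphicallyClosed {V : Pseudovariety} (h : V.FSaturated) :
    V.FEpimorphicallyClosed := by
  intro S T _ _ _ _ _ _ φ hφ hS
  have : Nonempty φ.srange := ⟨⟨_, Classical.arbitrary S, rfl⟩⟩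
  have hrange : V.Mem φ.srange := V.image S _ φ.srangeRestrict φ.srangeRestrict_surjective hS
  refine V.image S T φ (by_contra fun hsurj => ?_) hS
  refine h φ.srange hrange T (MulMemClass.subtype φ.srange) Subtype.val_injective ?_ ?_
  · refine fun hs => hsurj fun t => ?_
    obtain ⟨⟨_, s, rfl⟩, rfl⟩ := hs t
    exact ⟨s, rfl⟩
  · rw [← Dom_srange_eq_univ_iff_epi] at hφ
    rw [← hφ]
    congr 1
    ext t
    simp

theorem mem_of_injective {V : Pseudovariety} {S T : Type} [Semigroup S] [Finite S] [Nonempty S]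
    [Semigroup T] [Finite T] [Nonempty T] (φ : S →ₙ* T) (hφ : Function.Injective φ)
    (hT : V.Mem T) : V.Mem S := by
  have : Nonempty φ.srange := ⟨⟨_, Classical.arbitrary S, rfl⟩⟩
  let ψ : S ≃* φ.srange := MulEquiv.ofBijective φ.srangeRestrict
    ⟨fun a b h => hφ (congrArg Subtype.val h), φ.srangeRestrict_surjective⟩
  exact V.image φ.srange S ψ.symm.toMulHom ψ.symm.surjective (V.sub T φ.srange hT)

theorem mem_prod {V : Pseudovariety} {S T : Type} [Semigroup S] [Finite S] [Nonempty S]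
    [Semigroup T] [Finite T] [Nonempty T] (hS : V.Mem S) (hT : V.Mem T) : V.Mem (S × T) := by
  let F : Fin 2 → Type := ![S, T]
  let _ : ∀ i, Semigroup (F i) := Fin.cons ‹Semigroup S› (Fin.cons ‹Semigroup T› finZeroElim)
  have _ : ∀ i, Finite (F i) := Fin.cons ‹Finite S› (Fin.cons ‹Finite T› finZeroElim)
  have _ : ∀ i, Nonempty (F i) := Fin.cons ‹Nonempty S› (Fin.cons ‹Nonempty T› finZeroElim)
  have hF : V.Mem (∀ i, F i) := V.pi 2 F (Fin.cons hS (Fin.cons hT finZeroElim))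
  refine V.image (∀ i, F i) (S × T) ⟨fun p => (p 0, p 1), fun _ _ => rfl⟩ ?_ hF
  rintro ⟨s, t⟩
  exact ⟨Fin.cons s (Fin.cons t finZeroElim), rfl⟩

end Pseudovariety

/-! ### Brandt semigroups -/

/-- The Brandt semigroup over the monoid `M` with index set `I`: the matrix units with one entry
in `M`, together with a zero. -/
inductive Brandt (I M : Type) : Type
  | zero
  | unit (i : I) (m : M) (j : I)

namespace Brandt

variable {I M : Type}

instance : Nonempty (Brandt I M) := ⟨zero⟩

instance [Finite I] [Finite M] : Finite (Brandt I M) := by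
  let g : Brandt I M → Option (I × M × I)
    | zero => none
    | unit i m j => some (i, m, j)
  refine Finite.of_injective g fun x y h => ?_
  cases x <;> cases y <;> simp_all [g]

variable [DecidableEq I] [Monoid M]

/-- The multiplication of matrix units. -/
def mul : Brandt I M → Brandt I M → Brandt I M
  | unit i m j, unit k n l => if j = k then unit i (m * n) l else zero
  | _, _ => zero

instance : Semigroup (Brandt I M) where
  mul := mul
  mul_assoc x y z := by
    change mul (mul x y) z = mul x (mul y z)
    rcases x with _ | ⟨i, m, j⟩ <;> rcases y with _ | ⟨k, n, l⟩ <;> rcases z with _ | ⟨p, q, r⟩ <;>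
      simp only [mul] <;> split_ifs <;> simp_all [mul_assoc]

theorem unit_mul_unit (i j k : I) (m n : M) : unit i m j * unit j n k = unit i (m * n) k :=
  if_pos rfl

end Brandt

/-- The generalization of `Y` in which `a` is replaced by a family of elements; the products of
these elements with each other are zero. -/
inductive YFamily (M : Type) : Type
  | ab
  | a (m : M)
  | ba
  | zero

namespace YFamily

variable {M : Type}

instance : Nonempty (YFamily M) := ⟨zero⟩

instance [Finite M] : Finite (YFamily M) := by
  let g : YFamily M → Option (Option (Option M))
    | ab => none
    | ba => some none
    | zero => some (some none)
    | a m => some (some (some m))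
  refine Finite.of_injective g fun x y h => ?_
  cases x <;> cases y <;> simp_all [g]

/-- The multiplication of `YFamily M`; all products not listed are zero. -/
def mul : YFamily M → YFamily M → YFamily M
  | ab, ab => ab
  | ab, a m => a m
  | a m, ba => a m
  | ba, ba => ba
  | _, _ => zero

instance : Semigroup (YFamily M) where
  mul := mul
  mul_assoc x y z := by cases x <;> cases y <;> cases z <;> rfl

theorem mul_def (x y : YFamily M) : x * y = mul x y := rfl

/-- The morphism to `Y` that keeps the element indexed by `m` and kills the others. -/
def toY [DecidableEq M] (m : M) : YFamily M →ₙ* Y where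
  toFun
    | ab => Y.ab
    | a n => if n = m then Y.a else Y.zero
    | ba => Y.ba
    | zero => Y.zero
  map_mul' x y := by
    cases x <;> cases y <;> simp only [mul_def, mul] <;> (try split_ifs) <;> rfl

theorem ext_toY [DecidableEq M] [Nonempty M] {x y : YFamily M} (h : ∀ m, toY m x = toY m y) :
    x = y := by
  obtain ⟨m₀⟩ := ‹Nonempty M›
  have h₀ := h m₀
  cases x with
  | a m => have := h m; cases y <;> simp_all [toY]
  | _ =>
    cases y with
    | a m => have := h m; simp_all [toY]
    | _ => simp_all [toY]

/-- The embedding of `YFamily M` as the upper triangular matrix units whose diagonal entries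
are `1`. -/
def toBrandt (M : Type) [Monoid M] : YFamily M →ₙ* Brandt Bool M where
  toFun
    | ab => .unit false 1 false
    | a m => .unit false m true
    | ba => .unit true 1 true
    | zero => .zero
  map_mul' x y := by
    change _ = Brandt.mul _ _
    cases x <;> cases y <;> simp [Brandt.mul, mul_def, mul]

variable [Monoid M]

theorem toBrandt_injective : Function.Injective (toBrandt M) := by
  intro x y h
  cases x <;> cases y <;> simp_all [toBrandt]

theorem toBrandt_not_surjective : ¬ Function.Surjective (toBrandt M) := by
  intro h
  obtain ⟨x, hx⟩ := h (.unit true 1 false)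
  cases x <;> simp_all [toBrandt]

end YFamily

theorem eq_of_common_inverse {T : Type*} [Semigroup T] {a b b' : T} (hab : a * b = a * b')
    (hba : b * a = b' * a) (hb : b * a * b = b) (hb' : b' * a * b' = b') : b = b' :=
  calc b = b * (a * b) := by rw [← mul_assoc, hb]
    _ = b * a * b' := by rw [hab, mul_assoc]
    _ = b' := by rw [hba, hb']

open Brandt in
theorem Dom_srange_toBrandt (M : Type) [Monoid M] :
    Dom (YFamily.toBrandt M).srange = Set.univ := by
  refine Set.eq_univ_of_forall fun d T _ α β hαβ => ?_
  have hrange (y : YFamily M) : YFamily.toBrandt M y ∈ α.eqLocus β := hαβ _ ⟨y, rfl⟩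
  have ha (m : M) : unit false m true ∈ α.eqLocus β := hrange (.a m)
  have hab : α (unit false 1 false) = β (unit false 1 false) := hrange .ab
  have hba : α (unit true 1 true) = β (unit true 1 true) := hrange .ba
  have ha₁ : α (unit false 1 true) = β (unit false 1 true) := ha 1
  have hb : unit true 1 false ∈ α.eqLocus β := by
    refine eq_of_common_inverse (a := α (unit false 1 true)) ?_ ?_ ?_ ?_
    · conv_rhs => rw [ha₁]
      simpa only [← map_mul, unit_mul_unit, mul_one] using hab
    · conv_rhs => rw [ha₁]
      simpa only [← map_mul, unit_mul_unit, mul_one] using hba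
    · simp only [← map_mul, unit_mul_unit, mul_one]
    · simp only [ha₁, ← map_mul, unit_mul_unit, mul_one]
  have hrow (m : M) (j : Bool) : unit false m j ∈ α.eqLocus β := by
    cases j with
    | false => simpa only [unit_mul_unit, mul_one] using mul_mem (ha m) hb
    | true => exact ha m
  cases d with
  | zero => exact hrange .zero
  | unit i m j =>
    cases i with
    | false => exact hrow m j
    | true =>
      have h := mul_mem hb (hrow m j)
      rwa [unit_mul_unit, one_mul] at h

namespace Pseudovariety

variable {V W : Pseudovariety}

theorem mem_YFamily (hY : V.Mem Y) (M : Type) [Finite M] [Nonempty M] : V.Mem (YFamily M) := by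
  classical
  obtain ⟨n, ⟨e⟩⟩ := Finite.exists_equiv_fin M
  refine mem_of_injective (T := Fin n → Y)
    ⟨fun x i => YFamily.toY (e.symm i) x, fun x y => funext fun i => map_mul _ _ _⟩
    (fun x y h => YFamily.ext_toY fun m => ?_) (V.pi n (fun _ => Y) fun _ => hY)
  simpa using congrFun h (e m)

theorem not_fSaturated_of_mem_Y (hY : V.Mem Y) : ¬ V.FSaturated := fun h =>
  h (YFamily Unit) (mem_YFamily hY Unit) (Brandt Bool Unit) (YFamily.toBrandt Unit)
    YFamily.toBrandt_injective YFamily.toBrandt_not_surjective (Dom_srange_toBrandt Unit)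

theorem FEpimorphicallyClosed.mem_of_mem_Y (hW : W.FEpimorphicallyClosed) (hY : W.Mem Y)
    (S : Type) [Semigroup S] [Finite S] [Nonempty S] : W.Mem S := by
  have hB : W.Mem (Brandt Bool (WithOne S)) :=
    hW _ _ (YFamily.toBrandt (WithOne S))
      ((Dom_srange_eq_univ_iff_epi _).1 (Dom_srange_toBrandt _)) (mem_YFamily hY _)
  refine mem_of_injective ⟨fun s => Brandt.unit false (s : WithOne S) false, fun s t => ?_⟩
    (fun s t h => ?_) hB
  · rw [Brandt.unit_mul_unit, WithOne.coe_mul]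
  · simpa using h

theorem eq_allFinite_iff :
    W = allFinite ↔ ∀ (S : Type) [Semigroup S] [Finite S] [Nonempty S], W.Mem S := by
  refine ⟨?_, fun h => ?_⟩
  · rintro rfl S _ _ _
    trivial
  · obtain ⟨Mem, _, _, _⟩ := W
    unfold allFinite
    congr 1
    funext S _ _ _
    exact eq_true (h S)

theorem fEpimorphicallyClosed_allFinite : allFinite.FEpimorphicallyClosed :=
  fun _ _ _ _ _ _ _ _ _ _ _ => trivial

theorem le_allFinite (V : Pseudovariety) : V ≤ allFinite := fun _ _ _ _ _ => trivial

theorem fEpimorphicallyClosed_and_le_iff_of_mem_Y (hY : V.Mem Y) (W : Pseudovariety) :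
    (W.FEpimorphicallyClosed ∧ V ≤ W) ↔ W = allFinite := by
  constructor
  · rintro ⟨hW, hVW⟩
    exact eq_allFinite_iff.2 fun S => hW.mem_of_mem_Y (hVW Y hY) S
  · rintro rfl
    exact ⟨fEpimorphicallyClosed_allFinite, le_allFinite V⟩

end Pseudovariety

/-! ### Divisibility by `Y` -/

theorem Pseudovariety.mem_of_fibres {V : Pseudovariety} {P Q : Type} [Semigroup P] [Finite P]
    [Nonempty P] [Semigroup Q] [Finite Q] [Nonempty Q] (hP : V.Mem P) (F : Q → Set P)
    (hne : ∀ y, (F y).Nonempty) (hdisj : ∀ y z, y ≠ z → Disjoint (F y) (F z))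
    (hmul : ∀ y z, ∀ p ∈ F y, ∀ q ∈ F z, p * q ∈ F (y * z)) : V.Mem Q := by
  let U : Subsemigroup (P × Q) :=
    { carrier := {x | x.1 ∈ F x.2}
      mul_mem' := fun {x y} hx hy => hmul x.2 y.2 x.1 hx y.1 hy }
  obtain ⟨y⟩ := ‹Nonempty Q›
  have : Nonempty U := ⟨⟨((hne y).some, y), (hne y).some_mem⟩⟩
  have hfst : Function.Injective ((MulHom.fst P Q).comp (MulMemClass.subtype U)) := by
    rintro ⟨⟨p, y⟩, hy⟩ ⟨⟨_, z⟩, hz⟩ rfl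
    obtain rfl : y = z := by_contra fun h => Set.disjoint_left.1 (hdisj y z h) hy hz
    rfl
  refine V.image U Q ((MulHom.snd P Q).comp (MulMemClass.subtype U)) (fun y => ?_)
    (mem_of_injective _ hfst hP)
  exact ⟨⟨((hne y).some, y), (hne y).some_mem⟩, rfl⟩

section Exclusion

variable {P : Type} [Semigroup P] {V : Pseudovariety} {e s f : P}

/-- Sends `ab`, `a`, `ba`, `0` to `{e}`, `{s}`, `{f}`, `I`: the fibres that exhibit `Y` as a
divisor of a semigroup containing `e`, `s`, `f` and `I`. -/
def yFibre (e s f : P) (I : Set P) : Y → Set P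
  | .ab => {e}
  | .a => {s}
  | .ba => {f}
  | .zero => I

theorem mul_mem_yFibre {I : Set P} (he : IsIdempotentElem e) (hf : IsIdempotentElem f)
    (hes : e * s = s) (hsf : s * f = s) (hfe : f * e ∈ I) (hef : e * f ∈ I)
    (hI : ∀ c ∈ ({e, s, f} : Set P), ∀ x ∈ I, c * x ∈ I ∧ x * c ∈ I)
    (hII : ∀ x ∈ I, ∀ y ∈ I, x * y ∈ I) (y z : Y) :
    ∀ p ∈ yFibre e s f I y, ∀ q ∈ yFibre e s f I z, p * q ∈ yFibre e s f I (y * z) := by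
  have hse : s * e ∈ I := by rw [← hsf, mul_assoc]; exact (hI s (by simp) _ hfe).1
  have hfs : f * s ∈ I := by rw [← hes, ← mul_assoc]; exact (hI s (by simp) _ hfe).2
  have hss : s * s ∈ I := by
    have : s * s = s * (f * s) := by rw [← mul_assoc, hsf]
    exact this ▸ (hI s (by simp) _ hfs).1
  have hIe := hI e (by simp)
  have hIs := hI s (by simp)
  have hIf := hI f (by simp)
  rcases y <;> rcases z <;> simp only [yFibre, Set.mem_singleton_iff, forall_eq]
  exacts [he.eq, hes, hef, fun x hx => (hIe x hx).1,
    hse, hss, hsf, fun x hx => (hIs x hx).1,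
    hfe, hfs, hf.eq, fun x hx => (hIf x hx).1,
    fun x hx => (hIe x hx).2, fun x hx => (hIs x hx).2, fun x hx => (hIf x hx).2, hII]

theorem mem_Y_of_mem {I : Set P} [Finite P] [Nonempty P] (hP : V.Mem P) (he : IsIdempotentElem e)
    (hf : IsIdempotentElem f)
    (hes : e * s = s) (hsf : s * f = s) (hfe : f * e ∈ I) (hef : e * f ∈ I)
    (hI : ∀ c ∈ ({e, s, f} : Set P), ∀ x ∈ I, c * x ∈ I ∧ x * c ∈ I) (hs : s ∉ I) : V.Mem Y := by
  let A := Subsemigroup.closure ({e, s, f} : Set P)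
  have hA : ∀ c ∈ ({e, s, f} : Set P), c ∈ A := fun c hc => Subsemigroup.subset_closure hc
  have hIA : ∀ c ∈ A, ∀ x ∈ I, c * x ∈ I ∧ x * c ∈ I := fun c hc => by
    induction hc using Subsemigroup.closure_induction with
    | mem c hc => exact hI c hc
    | mul b c _ _ hb hc =>
      intro x hx
      rw [mul_assoc, ← mul_assoc x]
      exact ⟨(hb _ (hc x hx).1).1, (hc _ (hb x hx).2).2⟩
  have heA := hA e (by simp)
  have hfA := hA f (by simp)
  have he_notin : e ∉ I := fun h => hs (hes ▸ (hI s (by simp) e h).2)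
  have hf_notin : f ∉ I := fun h => hs (hsf ▸ (hI s (by simp) f h).1)
  have hef_ne : e ≠ f := by rintro rfl; exact he_notin (he.eq ▸ hef)
  have hes_ne : e ≠ s := by rintro rfl; exact hs (hsf ▸ hef)
  have hsf_ne : s ≠ f := by rintro rfl; exact hs (hes ▸ hef)
  refine Pseudovariety.mem_of_fibres hP (yFibre e s f (I ∩ A)) ?_ ?_ <|
    mul_mem_yFibre he hf hes hsf ⟨hfe, A.mul_mem hfA heA⟩ ⟨hef, A.mul_mem heA hfA⟩
      (fun c hc x hx => ⟨⟨(hI c hc x hx.1).1, A.mul_mem (hA c hc) hx.2⟩,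
        (hI c hc x hx.1).2, A.mul_mem hx.2 (hA c hc)⟩)
      fun x hx y hy => ⟨(hIA x hx.2 y hy.1).1, A.mul_mem hx.2 hy.2⟩
  · rintro (_ | _ | _ | _)
    exacts [⟨e, rfl⟩, ⟨s, rfl⟩, ⟨f, rfl⟩, ⟨f * e, hfe, A.mul_mem hfA heA⟩]
  · rintro (_ | _ | _ | _) (_ | _ | _ | _) hyz <;>
      simp_all [yFibre, hef_ne.symm, hes_ne.symm, hsf_ne.symm]

theorem eq_mul_or_mem_of_not_mem_Y [Finite P] [Nonempty P] (hP : V.Mem P) (hY : ¬ V.Mem Y)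
    (he : IsIdempotentElem e) (hf : IsIdempotentElem f) (hes : e * s = s) (hsf : s * f = s)
    {I : Set P} (hfe : f * e ∈ I)
    (hI : ∀ c ∈ ({e, s, f} : Set P), ∀ x ∈ I, c * x ∈ I ∧ x * c ∈ I) : s = e * f ∨ s ∈ I := by
  by_contra hs
  refine hY <| mem_Y_of_mem (I := insert (e * f) I) hP he hf hes hsf (.inr hfe) (.inl rfl) ?_ hs
  rintro c hc x (rfl | hx)
  · have hfs : f * s ∈ I := by rw [← hes, ← mul_assoc]; exact (hI s (by simp) _ hfe).2
    have hse : s * e ∈ I := by rw [← hsf, mul_assoc]; exact (hI s (by simp) _ hfe).1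
    rcases hc with rfl | rfl | rfl
    · refine ⟨.inl ?_, .inr ?_⟩
      · rw [← mul_assoc, he.eq]
      · rw [mul_assoc]; exact (hI c (by simp) _ hfe).1
    · refine ⟨.inr ?_, .inr ?_⟩
      · rw [← mul_assoc]; exact (hI f (by simp) _ hse).2
      · rw [mul_assoc]; exact (hI e (by simp) _ hfs).1
    · refine ⟨.inr ?_, .inl ?_⟩
      · rw [← mul_assoc]; exact (hI c (by simp) _ hfe).2
      · rw [mul_assoc, hf.eq]
  · exact ⟨.inr (hI c hc x hx).1, .inr (hI c hc x hx).2⟩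

end Exclusion

/-! ### Pseudovarieties without `Y` -/

section NotMemY

variable {V : Pseudovariety} {S : Type} [Semigroup S]

theorem exists_mul_mul_eq_pow {M : Type*} [Monoid M] {e f p : M} (he : IsIdempotentElem e)
    (hf : IsIdempotentElem f) (hp : p ∈ Submonoid.closure {e, f}) :
    ∃ n, e * p * f = (e * f) ^ (n + 1) := by
  suffices h : (∃ n, e * p * f = (e * f) ^ (n + 1)) ∧ ∃ n, e * f * p * f = (e * f) ^ (n + 1) from
    h.1
  induction hp using Submonoid.closure_induction_left with
  | one => exact ⟨⟨0, by simp⟩, ⟨0, by simp [mul_assoc, hf.eq]⟩⟩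
  | mul_left c hc p _ ih =>
    obtain ⟨⟨m, hm⟩, ⟨n, hn⟩⟩ := ih
    rcases hc with rfl | rfl
    · refine ⟨⟨m, by rw [← mul_assoc, he.eq, hm]⟩, ⟨m + 1, ?_⟩⟩
      rw [pow_succ', ← hm]
      simp only [mul_assoc]
    · exact ⟨⟨n, by rw [← mul_assoc, hn]⟩, ⟨n, by rw [← mul_assoc, mul_assoc e, hf.eq, hn]⟩⟩

variable [Finite S]

theorem omegaPow_mul_self_of_eq_mul_mul_mul {e f : S} (he : IsIdempotentElem e)
    (hf : IsIdempotentElem f) {p q : WithOne S} (hp : p ∈ Submonoid.closure {↑e, ↑f})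
    (hq : q ∈ Submonoid.closure {↑e, ↑f}) (h : ((e * f : S) : WithOne S) = p * (f * e) * q) :
    omegaPow (e * f) * (e * f) = e * f := by
  have heM : IsIdempotentElem (e : WithOne S) := congrArg _ he.eq
  have hfM : IsIdempotentElem (f : WithOne S) := congrArg _ hf.eq
  obtain ⟨m, hm⟩ := exists_mul_mul_eq_pow heM hfM hp
  obtain ⟨n, hn⟩ := exists_mul_mul_eq_pow heM hfM hq
  refine omegaPow_mul_of_coe_eq (q := ((e : WithOne S) * f) ^ (m + n)) ?_
  calc ((e * f : S) : WithOne S) = e * (e * f) * f := by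
        rw [← mul_assoc, heM.eq, mul_assoc, hfM.eq, WithOne.coe_mul]
    _ = (e * p * f) * (e * q * f) := by
        rw [← WithOne.coe_mul, h]; simp only [mul_assoc]
    _ = (e * f) ^ (2 + (m + n)) := by
        rw [hm, hn, ← pow_add]; congr 1; omega
    _ = _ := by rw [pow_add, sq, WithOne.coe_mul]

-- In `S × S` the second component leaves `(ef, efef) = (e, e)(f, f)` possible only for idempotent
-- `ef`.
theorem omegaPow_mul_self_of_not_mem_Y [Nonempty S] (hS : V.Mem S) (hY : ¬ V.Mem Y) {e f : S}
    (he : IsIdempotentElem e) (hf : IsIdempotentElem f) : omegaPow (e * f) * (e * f) = e * f := by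
  let N := Submonoid.closure {(e : WithOne S), (f : WithOne S)}
  have heN : (e : WithOne S) ∈ N := Submonoid.subset_closure (.inl rfl)
  have hfN : (f : WithOne S) ∈ N := Submonoid.subset_closure (.inr rfl)
  let I : Set (S × S) := {x | ∃ p ∈ N, ∃ q ∈ N, (x.1 : WithOne S) = p * (f * e) * q}
  have hI : ∀ c ∈ ({(e, e), (e * f, e * f * (e * f)), (f, f)} : Set (S × S)), ∀ x ∈ I,
      c * x ∈ I ∧ x * c ∈ I := by
    rintro c hc x ⟨p, hp, q, hq, hx⟩
    have hcN : (c.1 : WithOne S) ∈ N := by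
      rcases hc with rfl | rfl | rfl
      exacts [heN, N.mul_mem heN hfN, hfN]
    refine ⟨⟨c.1 * p, N.mul_mem hcN hp, q, hq, ?_⟩, ⟨p, hp, q * c.1, N.mul_mem hq hcN, ?_⟩⟩ <;>
      simp only [Prod.fst_mul, WithOne.coe_mul, hx, mul_assoc]
  have heS : IsIdempotentElem (e, e) := Prod.ext he he
  have hfS : IsIdempotentElem (f, f) := Prod.ext hf hf
  rcases eq_mul_or_mem_of_not_mem_Y (V.mem_prod hS hS) hY heS hfS
    (by simp only [Prod.mk_mul_mk, ← mul_assoc, he.eq])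
    (by simp only [Prod.mk_mul_mk, mul_assoc, hf.eq])
    (show (f, f) * (e, e) ∈ I from ⟨1, N.one_mem, 1, N.one_mem, by simp⟩) hI
    with h | ⟨p, hp, q, hq, h⟩
  · have hidem : IsIdempotentElem (e * f) := congrArg Prod.snd h
    rw [omegaPow_of_idempotent hidem, hidem.eq]
  · exact omegaPow_mul_self_of_eq_mul_mul_mul he hf hp hq h

section Stable

/-- The elements `x` with `(ef)^ω e x = e x`. -/
def leftStable (e f : S) : Set S := {x | omegaPow (e * f) * (e * x) = e * x}

/-- The elements `x` with `x f (ef)^ω = x f`. -/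
def rightStable (e f : S) : Set S := {x | x * f * omegaPow (e * f) = x * f}

variable {e f x c : S}

theorem mul_right_mem_leftStable (hx : x ∈ leftStable e f) (a : S) : x * a ∈ leftStable e f := by
  change omegaPow (e * f) * (e * (x * a)) = e * (x * a)
  rw [← mul_assoc e, ← mul_assoc, hx.out]

theorem mul_left_mem_rightStable (hx : x ∈ rightStable e f) (a : S) : a * x ∈ rightStable e f := by
  change a * x * f * omegaPow (e * f) = a * x * f
  rw [mul_assoc a, mul_assoc a, hx.out]

theorem mul_mem_leftStable (hef : omegaPow (e * f) * (e * f) = e * f) (x : S) :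
    f * x ∈ leftStable e f := by
  change omegaPow (e * f) * (e * (f * x)) = e * (f * x)
  rw [← mul_assoc e, ← mul_assoc, hef]

theorem mul_mem_rightStable (hef : omegaPow (e * f) * (e * f) = e * f) (x : S) :
    x * e ∈ rightStable e f := by
  change x * e * f * omegaPow (e * f) = x * e * f
  rw [mul_assoc x, mul_assoc x, ← omegaPow_mul_self_comm, hef]

theorem mul_left_mem_leftStable (he : IsIdempotentElem e)
    (hef : omegaPow (e * f) * (e * f) = e * f) (hc : c ∈ ({e, f} : Set S))
    (hx : x ∈ leftStable e f) : c * x ∈ leftStable e f := by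
  rcases hc with rfl | rfl
  · change omegaPow (c * f) * (c * (c * x)) = c * (c * x)
    rw [← mul_assoc c, he.eq, hx.out]
  · exact mul_mem_leftStable hef x

theorem mul_right_mem_rightStable (hf : IsIdempotentElem f)
    (hef : omegaPow (e * f) * (e * f) = e * f) (hc : c ∈ ({e, f} : Set S))
    (hx : x ∈ rightStable e f) : x * c ∈ rightStable e f := by
  rcases hc with rfl | rfl
  · exact mul_mem_rightStable hef x
  · change x * c * c * omegaPow (e * c) = x * c * c
    rw [mul_assoc x, hf.eq, hx.out]

theorem omegaPow_mul_of_mem_leftStable (hes : e * c = c) (hc : c ∈ leftStable e f) :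
    omegaPow (e * f) * c = c :=
  hes ▸ hc.out

theorem mul_omegaPow_of_mem_rightStable (hsf : c * f = c) (hc : c ∈ rightStable e f) :
    c * omegaPow (e * f) = c :=
  hsf ▸ hc.out

end Stable

/-- Every local submonoid `gSg`, with `g` idempotent, is completely regular. -/
def IsLocallyCompletelyRegular (S : Type) [Semigroup S] [Finite S] : Prop :=
  ∀ g t : S, IsIdempotentElem g → g * t = t → t * g = t → omegaPow t * t = t

theorem IsLocallyCompletelyRegular.omegaPow_mul_self_of_JLe_mul_left
    (hloc : IsLocallyCompletelyRegular S) {e s : S} (he : IsIdempotentElem e) (hes : e * s = s)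
    (h : JLe (s : WithOne S) (s * e)) : omegaPow s * s = s := by
  obtain ⟨w, hw⟩ := h.exists_mul_right
  have hse : omegaPow (s * e) * (s * e) = s * e :=
    hloc e _ he (by rw [← mul_assoc, hes]) (by rw [mul_assoc, he.eq])
  have hs : omegaPow (s * e) * s = s := WithOne.coe_inj.1 <| by
    rw [WithOne.coe_mul, hw, ← mul_assoc, ← WithOne.coe_mul, ← WithOne.coe_mul, hse]
  have hconj : SemiconjBy s s (s * e) := by rw [SemiconjBy, mul_assoc, hes]
  rw [omegaPow_mul_self_comm, (semiconjBy_omegaPow hconj).eq, hs]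

theorem IsLocallyCompletelyRegular.omegaPow_mul_self_of_JLe_mul_right
    (hloc : IsLocallyCompletelyRegular S) {f s : S} (hf : IsIdempotentElem f) (hsf : s * f = s)
    (h : JLe (s : WithOne S) (f * s)) : omegaPow s * s = s := by
  obtain ⟨w, hw⟩ := h.exists_mul_left
  have hfs : omegaPow (f * s) * (f * s) = f * s :=
    hloc f _ hf (by rw [← mul_assoc, hf.eq]) (by rw [mul_assoc, hsf])
  have hs : s * omegaPow (f * s) = s := WithOne.coe_inj.1 <| by
    rw [WithOne.coe_mul, hw, mul_assoc, ← WithOne.coe_mul, ← WithOne.coe_mul,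
      ← omegaPow_mul_self_comm, hfs]
  have hconj : SemiconjBy s (f * s) s := by rw [SemiconjBy, ← mul_assoc, hsf]
  rw [← (semiconjBy_omegaPow hconj).eq, hs]

theorem JLe_or_JLe_or_mem_of_not_mem_Y [Nonempty S] (hS : V.Mem S) (hY : ¬ V.Mem Y) {e f s : S}
    (he : IsIdempotentElem e) (hf : IsIdempotentElem f) (hes : e * s = s) (hsf : s * f = s) :
    s = e * f ∨ (JLe (s : WithOne S) (s * e) ∨ JLe (s : WithOne S) (f * s)) ∨
      s ∈ leftStable e f ∧ s ∈ rightStable e f := by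
  have hef := omegaPow_mul_self_of_not_mem_Y hS hY he hf
  let D : Set S := {x | JLe (x : WithOne S) (s * e) ∨ JLe (x : WithOne S) (f * s)}
  have hseD : s * e ∈ D := .inl (.refl _)
  have hfsD : f * s ∈ D := .inr (.refl _)
  have hD : ∀ x ∈ D, ∀ c, c * x ∈ D ∧ x * c ∈ D := fun x hx c =>
    ⟨hx.imp (JLe.mul_left (c : WithOne S) x).trans (JLe.mul_left (c : WithOne S) x).trans,
      hx.imp (JLe.mul_right (x : WithOne S) c).trans (JLe.mul_right (x : WithOne S) c).trans⟩
  let C : Set S := {x | s * x ∈ D ∧ x * s ∈ D ∧ x ∈ leftStable e f ∧ x ∈ rightStable e f}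
  have hfeC : f * e ∈ C :=
    ⟨by rwa [← mul_assoc, hsf], by rwa [mul_assoc, hes], mul_mem_leftStable hef e,
      mul_mem_rightStable hef f⟩
  have hC : ∀ c ∈ ({e, f} : Set S), ∀ x ∈ C, c * x ∈ C ∧ x * c ∈ C := by
    rintro c hc x ⟨hsx, hxs, hxL, hxR⟩
    have hscx : s * (c * x) ∈ D := by
      rcases hc with rfl | rfl <;> rw [← mul_assoc]
      exacts [(hD _ hseD x).2, by rwa [hsf]]
    have hxcs : x * c * s ∈ D := by
      rcases hc with rfl | rfl <;> rw [mul_assoc]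
      exacts [by rwa [hes], (hD _ hfsD x).1]
    exact ⟨⟨hscx, mul_assoc c x s ▸ (hD _ hxs c).1, mul_left_mem_leftStable he hef hc hxL,
        mul_left_mem_rightStable hxR c⟩,
      ⟨mul_assoc s x c ▸ (hD _ hsx c).2, hxcs, mul_right_mem_leftStable hxL c,
        mul_right_mem_rightStable hf hef hc hxR⟩⟩
  have hI : ∀ c ∈ ({e, s, f} : Set S), ∀ x ∈ D ∪ C, c * x ∈ D ∪ C ∧ x * c ∈ D ∪ C := by
    rintro c hc x (hx | hx)
    · exact (hD x hx c).imp .inl .inl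
    · rcases hc with rfl | rfl | rfl
      exacts [(hC _ (.inl rfl) x hx).imp .inr .inr, ⟨.inl hx.1, .inl hx.2.1⟩,
        (hC _ (.inr rfl) x hx).imp .inr .inr]
  exact (eq_mul_or_mem_of_not_mem_Y hS hY he hf hes hsf (.inr hfeC) hI).imp_right
    (.imp_right fun h => h.2.2)

theorem IsLocallyCompletelyRegular.omegaPow_mul_self [Nonempty S]
    (hloc : IsLocallyCompletelyRegular S) (hS : V.Mem S) (hY : ¬ V.Mem Y) {e f s : S}
    (he : IsIdempotentElem e) (hf : IsIdempotentElem f) (hes : e * s = s) (hsf : s * f = s) :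
    omegaPow s * s = s := by
  rcases JLe_or_JLe_or_mem_of_not_mem_Y hS hY he hf hes hsf with rfl | (h | h) | ⟨hL, hR⟩
  · exact omegaPow_mul_self_of_not_mem_Y hS hY he hf
  · exact hloc.omegaPow_mul_self_of_JLe_mul_left he hes h
  · exact hloc.omegaPow_mul_self_of_JLe_mul_right hf hsf h
  · exact hloc (omegaPow (e * f)) s (omegaPow_idempotent _) (omegaPow_mul_of_mem_leftStable hes hL)
      (mul_omegaPow_of_mem_rightStable hsf hR)

end NotMemY

section StableSet

variable {V : Pseudovariety} {S R : Type} [Semigroup S] [Semigroup R] [Finite R] {g t : S}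
  {e f s : R}

/-- A set closed under multiplication by `(g, e)`, `(t, s)` and `(g, f)` which, if `t` is not a
group element, contains `(t, s)` only when `s` is stable under `(ef)^ω` on one side. -/
def stableSet (g t : S) (e f : R) : Set (S × R) :=
  {x | x.1 = g ∧ x.2 ∈ leftStable e f ∧ x.2 ∈ rightStable e f ∨
    x.1 = t ∧ (x.2 ∈ leftStable e f ∨ x.2 ∈ rightStable e f) ∨
    ∃ u, (x.1 : WithOne S) = t * t * u}

theorem mul_mem_stableSet_of_idempotents (hg : IsIdempotentElem g) (hgt : g * t = t)
    (htg : t * g = t) (he : IsIdempotentElem e) (hf : IsIdempotentElem f)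
    (hef : omegaPow (e * f) * (e * f) = e * f) :
    ∀ c ∈ ({e, f} : Set R), ∀ x ∈ stableSet g t e f,
      (g, c) * x ∈ stableSet g t e f ∧ x * (g, c) ∈ stableSet g t e f := by
  rintro c hc ⟨a, x⟩ (⟨rfl, hxL, hxR⟩ | ⟨rfl, hx⟩ | ⟨u, hu⟩)
  · exact ⟨.inl ⟨hg, mul_left_mem_leftStable he hef hc hxL, mul_left_mem_rightStable hxR c⟩,
      .inl ⟨hg, mul_right_mem_leftStable hxL c, mul_right_mem_rightStable hf hef hc hxR⟩⟩
  · exact ⟨.inr <| .inl ⟨hgt, hx.imp (mul_left_mem_leftStable he hef hc)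
        (mul_left_mem_rightStable · c)⟩,
      .inr <| .inl ⟨htg, hx.imp (mul_right_mem_leftStable · c)
        (mul_right_mem_rightStable hf hef hc)⟩⟩
  · refine ⟨.inr <| .inr ⟨u, ?_⟩, .inr <| .inr ⟨u * g, ?_⟩⟩
    · rw [Prod.mk_mul_mk, WithOne.coe_mul, hu, ← mul_assoc, ← mul_assoc, ← WithOne.coe_mul, hgt]
    · rw [Prod.mk_mul_mk, WithOne.coe_mul, hu, mul_assoc _ u]

theorem mul_mem_stableSet (hgt : g * t = t) (htg : t * g = t) (s : R) :
    ∀ x ∈ stableSet g t e f,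
      (t, s) * x ∈ stableSet g t e f ∧ x * (t, s) ∈ stableSet g t e f := by
  rintro ⟨a, x⟩ (⟨rfl, hxL, hxR⟩ | ⟨rfl, -⟩ | ⟨u, hu⟩)
  · exact ⟨.inr <| .inl ⟨htg, .inr (mul_left_mem_rightStable hxR s)⟩,
      .inr <| .inl ⟨hgt, .inl (mul_right_mem_leftStable hxL s)⟩⟩
  · exact ⟨.inr <| .inr ⟨1, by simp⟩, .inr <| .inr ⟨1, by simp⟩⟩
  · refine ⟨.inr <| .inr ⟨t * u, ?_⟩, .inr <| .inr ⟨u * t, ?_⟩⟩ <;>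
      simp only [Prod.mk_mul_mk, WithOne.coe_mul, hu, mul_assoc]

theorem mul_omegaPow_or_omegaPow_mul_of_not_mem_Y [Finite S] [Nonempty S] [Nonempty R]
    (hS : V.Mem S) (hR : V.Mem R) (hY : ¬ V.Mem Y) (hg : IsIdempotentElem g) (hgt : g * t = t)
    (htg : t * g = t) (ht : omegaPow t * t ≠ t) (he : IsIdempotentElem e)
    (hf : IsIdempotentElem f) (hes : e * s = s) (hsf : s * f = s) :
    s * omegaPow (e * f) = s ∨ omegaPow (e * f) * s = s := by
  have hef := omegaPow_mul_self_of_not_mem_Y hR hY he hf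
  have htg_ne : t ≠ g := by
    rintro rfl
    exact ht (by rw [omegaPow_of_idempotent hg, hg.eq])
  have hE : IsIdempotentElem (g, e) := Prod.ext hg he
  have hF : IsIdempotentElem (g, f) := Prod.ext hg hf
  have hideal := mul_mem_stableSet_of_idempotents hg hgt htg he hf hef
  have hI : ∀ c ∈ ({(g, e), (t, s), (g, f)} : Set (S × R)), ∀ x ∈ stableSet g t e f,
      c * x ∈ stableSet g t e f ∧ x * c ∈ stableSet g t e f := by
    rintro _ (rfl | rfl | rfl)
    exacts [hideal e (.inl rfl), mul_mem_stableSet hgt htg s, hideal f (.inr rfl)]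
  rcases eq_mul_or_mem_of_not_mem_Y (V.mem_prod hS hR) hY hE hF
    (Prod.ext hgt hes) (Prod.ext htg hsf)
    (.inl ⟨hg, mul_mem_leftStable hef e, mul_mem_rightStable hef f⟩) hI
    with h | h | h | ⟨u, h⟩
  · exact absurd ((congrArg Prod.fst h).trans hg.eq) htg_ne
  · exact absurd h.1 htg_ne
  · exact h.2.symm.imp (mul_omegaPow_of_mem_rightStable hsf) (omegaPow_mul_of_mem_leftStable hes)
  · exact absurd (omegaPow_mul_of_coe_eq h) ht

end StableSet

namespace Pseudovariety

variable {V : Pseudovariety}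

theorem le_V₁_of_isLocallyCompletelyRegular (hY : ¬ V.Mem Y)
    (hloc : ∀ (S : Type) [Semigroup S] [Finite S] [Nonempty S], V.Mem S →
      IsLocallyCompletelyRegular S) : V ≤ V₁ :=
  fun S _ _ _ hS e x f he hf => (hloc S hS).omegaPow_mul_self hS hY he hf
    (by rw [← mul_assoc, ← mul_assoc, he.eq]) (by rw [mul_assoc, hf.eq])

theorem le_V₂_or_le_V₃_of_not_isLocallyCompletelyRegular (hY : ¬ V.Mem Y) {S : Type}
    [Semigroup S] [Finite S] [Nonempty S] (hS : V.Mem S) (hloc : ¬ IsLocallyCompletelyRegular S) :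
    V ≤ V₂ ∨ V ≤ V₃ := by
  simp only [IsLocallyCompletelyRegular, not_forall] at hloc
  obtain ⟨g, t, hg, hgt, htg, ht⟩ := hloc
  by_contra hcon
  rw [not_or] at hcon
  obtain ⟨h₂, h₃⟩ := hcon
  simp only [LE.le, V₂, V₃, ofPseudoidentity, not_forall] at h₂ h₃
  obtain ⟨A, _, _, _, hA, e, x, f, he, hf, hne⟩ := h₂
  obtain ⟨B, _, _, _, hB, e', x', f', he', hf', hne'⟩ := h₃
  have hE : IsIdempotentElem (e, e') := Prod.ext he he'
  have hF : IsIdempotentElem (f, f') := Prod.ext hf hf'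
  rcases mul_omegaPow_or_omegaPow_mul_of_not_mem_Y hS (V.mem_prod hA hB) hY hg hgt htg ht hE hF
    (s := (e, e') * (x, x') * (f, f')) (by rw [← mul_assoc, ← mul_assoc, hE.eq])
    (by rw [mul_assoc, hF.eq]) with h | h
  · have hfst := congrArg (MulHom.fst A B) h
    rw [map_mul, map_omegaPow] at hfst
    exact hne hfst
  · have hsnd := congrArg (MulHom.snd A B) h
    rw [map_mul, map_omegaPow] at hsnd
    exact hne' hsnd

theorem le_of_not_mem_Y (hY : ¬ V.Mem Y) : V ≤ V₁ ∨ V ≤ V₂ ∨ V ≤ V₃ := by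
  by_cases hloc : ∀ (S : Type) [Semigroup S] [Finite S] [Nonempty S], V.Mem S →
      IsLocallyCompletelyRegular S
  · exact .inl (le_V₁_of_isLocallyCompletelyRegular hY hloc)
  · simp only [not_forall] at hloc
    obtain ⟨S, _, _, _, hS, hloc⟩ := hloc
    exact .inr (le_V₂_or_le_V₃_of_not_isLocallyCompletelyRegular hY hS hloc)

theorem fSaturated_iff_not_mem_Y : V.FSaturated ↔ ¬ V.Mem Y :=
  ⟨fun h hY => not_fSaturated_of_mem_Y hY h, fun hY => fSaturated_of_le (le_of_not_mem_Y hY)⟩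

end Pseudovariety

/-! ### Deciding F-saturation -/

/-- An enumeration of `Y`. -/
def finEquivY : Fin 4 ≃ Y where
  toFun := ![Y.ab, Y.a, Y.ba, Y.zero]
  invFun
    | Y.ab => 0
    | Y.a => 1
    | Y.ba => 2
    | Y.zero => 3
  left_inv i := by fin_cases i <;> rfl
  right_inv y := by cases y <;> rfl

/-- Run a program on the multiplication table of `Y` and test whether it returns `0`. -/
def rejectsY (c : Nat.Partrec.Code) : Part Bool :=
  (c.eval (Encodable.encode (mulTable finEquivY))).map fun n => decide (n = 0)

theorem partrec_rejectsY : Partrec rejectsY := by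
  refine Partrec.map (Nat.Partrec.Code.eval_part.comp Computable.id (Computable.const _)) ?_
  have h : PrimrecPred fun n : ℕ => n = 0 := Primrec.eq.comp Primrec.id (Primrec.const 0)
  exact (h.decide.to_comp.comp Computable.snd).to₂

theorem rejectsY_spec {V : Pseudovariety} {c : Nat.Partrec.Code} (h : DecidesMembership c V) :
    (¬ V.Mem Y → true ∈ rejectsY c) ∧ (V.Mem Y → false ∈ rejectsY c) :=
  ⟨fun hY => (Part.mem_map_iff _).2 ⟨0, (h Y 4 finEquivY).2 hY, rfl⟩,
    fun hY => (Part.mem_map_iff _).2 ⟨1, (h Y 4 finEquivY).1 hY, rfl⟩⟩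

end FinSemigroup

open FinSemigroup Pseudovariety in
theorem theoremt :
    (∀ V : Pseudovariety,
      -- exactly one of the two alternatives holds
      Xor (V.FSaturated ∧ V.FEpimorphicallyClosed ∧ (V ≤ V₁ ∨ V ≤ V₂ ∨ V ≤ V₃))
        (¬ V.FSaturated ∧
          ∀ W : Pseudovariety, (W.FEpimorphicallyClosed ∧ V ≤ W) ↔ W = allFinite) ∧
      -- the second alternative holds exactly when `Y` belongs to `V`
      ((¬ V.FSaturated ∧
          ∀ W : Pseudovariety, (W.FEpimorphicallyClosed ∧ V ≤ W) ↔ W = allFinite) ↔ V.Mem Y) ∧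
      -- the case of proper pseudovarieties
      (V ≠ allFinite → (V.FEpimorphicallyClosed ↔ V.FSaturated))) ∧
    -- a single algorithm decides F-saturation of `V` from any program deciding membership in `V`
    (∃ F : Nat.Partrec.Code →. Bool, Partrec F ∧
      ∀ (V : Pseudovariety) (c : Nat.Partrec.Code), DecidesMembership c V →
        (V.FSaturated → true ∈ F c) ∧ (¬ V.FSaturated → false ∈ F c)) := by
  refine ⟨fun V => ?_, rejectsY, partrec_rejectsY, fun V c hc => ?_⟩
  · by_cases hY : V.Mem Y
    · have hns := not_fSaturated_of_mem_Y hY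
      have hall := fEpimorphicallyClosed_and_le_iff_of_mem_Y hY
      refine ⟨.inr ⟨⟨hns, hall⟩, fun h => hns h.1⟩, ⟨fun _ => hY, fun _ => ⟨hns, hall⟩⟩,
        fun hV => ⟨fun h => ?_, fun h => absurd h hns⟩⟩
      exact absurd ((hall V).1 ⟨h, fun _ _ _ _ hS => hS⟩) hV
    · have hs := fSaturated_iff_not_mem_Y.2 hY
      exact ⟨.inl ⟨⟨hs, hs.fEpimorphicallyClosed, le_of_not_mem_Y hY⟩, fun h => h.1 hs⟩,
        ⟨fun h => absurd hs h.1, fun h => absurd h hY⟩,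
        fun _ => ⟨fun _ => hs, fun h => h.fEpimorphicallyClosed⟩⟩
  · rw [fSaturated_iff_not_mem_Y, not_not]
    exact rejectsY_spec hc
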